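/- Let $n\ge 2$ and let $f\in W^{1,1}(\mathbb R^n)$ be real-valued, with weak gradient $\nabla f$. For $0<\alpha<1$ put $$\mathcal D^\alpha f(x)=\int_{\mathbb R^n}\frac{|f(x)-f(y)|}{|x-y|^{n+\alpha}}\,dy\in[0,\infty],$$ and for $0<\alpha<n$ and $g\ge 0$ let $$I_\alpha g(x)=\gamma_{n,\alpha}\int_{\mathbb R^n}\frac{g(y)}{|x-y|^{n-\alpha}}\,dy\in[0,\infty],\qquad \gamma_{n,\alpha}=\frac{\Gamma\left(\frac{n-\alpha}{2}\right)}{2^\alpha\pi^{n/2}\,\Gamma\left(\frac{\alpha}{2}\right)},$$ be the Riesz potential. Let $$K_n=\int_{\mathbb S^{n-1}}|\omega\cdot e|\,d\sigma(\omega),$$ where $\sigma$ is the surface measure on the unit sphere and $e\in\mathbb S^{n-1}$ is arbitrary. Then for every sequence $(\alpha_k)_k\subset(0,1)$ with $\alpha_k\to 1$ there is a subsequence $(\alpha_{k_j})_j$ such that, for almost every $x\in\mathbb R^n$, the quantities $I_{\alpha_{k_j}}(\mathcal D^{\alpha_{k_j}}f)(x)$ for all $j$, and $I_1(|\nabla f|)(x)$,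 are finite and $$\lim_{j\to\infty}(1-\alpha_{k_j})\,I_{\alpha_{k_j}}(\mathcal D^{\alpha_{k_j}}f)(x)=K_n\,I_1(|\nabla f|)(x).$$ -/

import Mathlib

open MeasureTheory Filter Topology
open scoped ENNReal

noncomputable section

namespace RieszBBM

/-- `g` is the weak (distributional) gradient of `f` on `ℝⁿ`: both are locally integrable and
`∫ f ∂ᵥφ = - ∫ φ (g · v)` for every test function `φ ∈ C_c^∞(ℝⁿ)` and every direction `v`. -/
structure IsWeakGradient {n : ℕ} (f : EuclideanSpace ℝ (Fin n) → ℝ)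
    (g : EuclideanSpace ℝ (Fin n) → EuclideanSpace ℝ (Fin n)) : Prop where
  locallyIntegrable_fun : LocallyIntegrable f volume
  locallyIntegrable_grad : LocallyIntegrable g volume
  integral_by_parts : ∀ φ : EuclideanSpace ℝ (Fin n) → ℝ, ContDiff ℝ ((⊤ : ℕ∞) : WithTop ℕ∞) φ →
    HasCompactSupport φ →
    ∀ v : EuclideanSpace ℝ (Fin n),
      ∫ x, f x * fderiv ℝ φ x v = - ∫ x, φ x * inner ℝ (g x) v

/-- The (real-valued) Sobolev space `W^{1,1}(ℝⁿ)`: integrable functions with an integrable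
weak gradient. -/
def MemW11 {n : ℕ} (f : EuclideanSpace ℝ (Fin n) → ℝ) : Prop :=
  Integrable f volume ∧
    ∃ g : EuclideanSpace ℝ (Fin n) → EuclideanSpace ℝ (Fin n),
      Integrable g volume ∧ IsWeakGradient f g

/-- The normalization constant
`γ_{n,α} = Γ((n - α) / 2) / (2 ^ α π ^ (n / 2) Γ(α / 2))` of the Riesz potential. -/
def rieszConst (n : ℕ) (α : ℝ) : ℝ :=
  Real.Gamma (((n : ℝ) - α) / 2) /
    ((2 : ℝ) ^ α * Real.pi ^ ((n : ℝ) / 2) * Real.Gamma (α / 2))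

/-- The Riesz potential `I_α g(x) = γ_{n,α} ∫ g(y) / |x - y|^{n - α} dy` of a nonnegative
function `g`, with values in `[0, ∞]`. -/
def rieszPotential {n : ℕ} (α : ℝ) (g : EuclideanSpace ℝ (Fin n) → ℝ≥0∞)
    (x : EuclideanSpace ℝ (Fin n)) : ℝ≥0∞ :=
  ENNReal.ofReal (rieszConst n α) *
    ∫⁻ y, g y / ENNReal.ofReal (‖x - y‖ ^ ((n : ℝ) - α))

/-- The nonlinear fractional differential operator
`𝒟^α f(x) = ∫ |f(x) - f(y)| / |x - y|^{n + α} dy`, with values in `[0, ∞]`. -/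
def fracDeriv {n : ℕ} (α : ℝ) (f : EuclideanSpace ℝ (Fin n) → ℝ)
    (x : EuclideanSpace ℝ (Fin n)) : ℝ≥0∞ :=
  ∫⁻ y, ENNReal.ofReal |f x - f y| / ENNReal.ofReal (‖x - y‖ ^ ((n : ℝ) + α))

/-- `∫_{𝕊^{n-1}} |ω · e| dσ(ω)`, where `σ` is the surface measure on the unit sphere. For unit
vectors `e` this is the constant `K_n`. -/
def sphereConst {n : ℕ} (e : EuclideanSpace ℝ (Fin n)) : ℝ :=
  ∫ ω : Metric.sphere (0 : EuclideanSpace ℝ (Fin n)) 1,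
    |inner ℝ (ω : EuclideanSpace ℝ (Fin n)) e|
      ∂(volume : Measure (EuclideanSpace ℝ (Fin n))).toSphere

end RieszBBM

end

/-! Write `g` for the gradient and split `f (x + h) - f x` into `⟪g x, h⟫`, restricted to `‖h‖ < 1`,
plus a defect. In polar coordinates the linear part contributes exactly `K_n ‖g x‖` to `(1 - α) 𝒟^α
f(x)` for every `α < 1`, since `∫₀¹ r ^ (-α) dr = 1 / (1 - α)`. Hence `|(1 - α) 𝒟^α f - K_n ‖g‖| ≤
R_α` pointwise wherever this makes sense, where `R_α` is `remainder`.

The key estimate is `‖R_α‖₁ → 0` (`tendsto_lintegral_remainder`). For `‖h‖ < 1` the fundamental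
theorem of calculus along translations bounds the `L¹` norm of the defect by `‖h‖ Ω(h)`, where `Ω`
averages `‖g(· + t h) - g‖₁` over `t ∈ (0, 1]`; it is bounded and tends to `0` with `h`, while `(1 -
α) ‖h‖ ^ (1 - n - α)` concentrates at the origin. For `‖h‖ ≥ 1` the crude bound `2 ‖f‖₁` suffices,
because of the factor `1 - α`.

Riesz potentials do not preserve `L¹`, so a subsequence is chosen with `‖R_j‖₁ ≤ 2 ^ (-j)`. Then `∑
R_j` is integrable, and its potential with the `α`-independent majorant kernel `‖x‖ ^ (-(n - 1/2)) +
1` is finite a.e.; thus the potentials of `R_j` tend to `0` a.e. Dominated convergence treats `K_n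
‖g‖`, and a squeeze concludes. -/

namespace RieszBBM

/-! ### Polar coordinates and power kernels -/

open Set Metric in
/-- Integration in polar coordinates for nonnegative functions. -/
theorem lintegral_polar {E : Type*} [NormedAddCommGroup E] [NormedSpace ℝ E]
    [FiniteDimensional ℝ E] [MeasurableSpace E] [BorelSpace E] [Nontrivial E]
    (μ : Measure E) [μ.IsAddHaarMeasure] {F : E → ℝ≥0∞} (hF : Measurable F) :
    ∫⁻ x, F x ∂μ = ∫⁻ ω : sphere (0 : E) 1, (∫⁻ r in Ioi (0 : ℝ),
      ENNReal.ofReal (r ^ (Module.finrank ℝ E - 1)) * F (r • (ω : E))) ∂μ.toSphere := by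
  have hmeas : Measurable fun p : sphere (0 : E) 1 × Ioi (0 : ℝ) => F ((p.2 : ℝ) • (p.1 : E)) := by
    fun_prop
  calc ∫⁻ x, F x ∂μ = ∫⁻ x in ({0}ᶜ : Set E), F x ∂μ := by rw [restrict_compl_singleton]
    _ = ∫⁻ x : ({0}ᶜ : Set E), F x ∂(μ.comap (↑)) := by
      rw [← lintegral_subtype_comap (measurableSet_singleton _).compl]
    _ = ∫⁻ p, F ((p.2 : ℝ) • (p.1 : E))
          ∂(μ.toSphere.prod (Measure.volumeIoiPow (Module.finrank ℝ E - 1))) := by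
      rw [← μ.measurePreserving_homeomorphUnitSphereProd.lintegral_comp hmeas]
      refine lintegral_congr fun x => ?_
      congr 1
      have hx : ‖(x : E)‖ ≠ 0 := norm_ne_zero_iff.2 x.2
      simp [smul_smul, mul_inv_cancel₀ hx]
    _ = _ := by
      rw [lintegral_prod _ hmeas.aemeasurable]
      refine lintegral_congr fun ω => ?_
      rw [Measure.volumeIoiPow, lintegral_withDensity_eq_lintegral_mul _ (by fun_prop)
        (by fun_prop)]
      exact lintegral_subtype_comap measurableSet_Ioi
        (fun r : ℝ => ENNReal.ofReal (r ^ (Module.finrank ℝ E - 1)) * F (r • (ω : E)))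

theorem setLIntegral_Ioo_rpow {a : ℝ} (ha : 0 < a) :
    ∫⁻ r in Set.Ioo (0 : ℝ) 1, ENNReal.ofReal (r ^ (a - 1)) = (ENNReal.ofReal a)⁻¹ := by
  rw [Measure.restrict_congr_set Ioo_ae_eq_Ioc, ← ofReal_integral_eq_lintegral_ofReal,
    ← intervalIntegral.integral_of_le zero_le_one, integral_rpow (Or.inl (by linarith))]
  · rw [sub_add_cancel, Real.one_rpow, Real.zero_rpow ha.ne', sub_zero, one_div,
      ENNReal.ofReal_inv_of_pos ha]
  · exact (intervalIntegral.intervalIntegrable_rpow' (by linarith)).1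
  · filter_upwards [self_mem_ae_restrict measurableSet_Ioc] with r hr
    exact Real.rpow_nonneg hr.1.le _

variable {n : ℕ}

/-- The kernel `‖x‖ ^ (-p)` with values in `[0, ∞]`. -/
noncomputable def invPow (p : ℝ) (x : EuclideanSpace ℝ (Fin n)) : ℝ≥0∞ :=
  (ENNReal.ofReal (‖x‖ ^ p))⁻¹

@[fun_prop]
theorem measurable_invPow (p : ℝ) : Measurable (invPow p : EuclideanSpace ℝ (Fin n) → ℝ≥0∞) := by
  unfold invPow; fun_prop

/-- The origin is excluded because for `p ≠ 0` the left side is `∞` there, whereas the real power `0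
^ (-p)` is `0`. -/
theorem invPow_of_ne_zero (p : ℝ) {x : EuclideanSpace ℝ (Fin n)} (hx : x ≠ 0) :
    invPow p x = ENNReal.ofReal (‖x‖ ^ (-p)) := by
  have : 0 < ‖x‖ := norm_pos_iff.2 hx
  rw [invPow, ← ENNReal.ofReal_inv_of_pos (by positivity), Real.rpow_neg this.le]

theorem nontrivial_euclideanSpace (hn : n ≠ 0) : Nontrivial (EuclideanSpace ℝ (Fin n)) := by
  have : NeZero n := ⟨hn⟩
  infer_instance

open Set Metric in
/-- On the unit ball, functions homogeneous of degree `q` are integrable against `‖x‖ ^ (-p)` in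
terms of their spherical integrals. -/
theorem setLIntegral_ball_mul_invPow (hn : n ≠ 0) {F : EuclideanSpace ℝ (Fin n) → ℝ≥0∞}
    (hF : Measurable F) {q p a : ℝ} (ha : 0 < a) (hpq : q - p = a - n)
    (hom : ∀ r : ℝ, 0 < r → ∀ x, F (r • x) = ENNReal.ofReal (r ^ q) * F x) :
    ∫⁻ x in ball (0 : EuclideanSpace ℝ (Fin n)) 1, F x * invPow p x =
      (∫⁻ ω : sphere (0 : EuclideanSpace ℝ (Fin n)) 1, F ω
        ∂(volume : Measure (EuclideanSpace ℝ (Fin n))).toSphere) * (ENNReal.ofReal a)⁻¹ := by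
  have := nontrivial_euclideanSpace hn
  rw [← lintegral_indicator measurableSet_ball, lintegral_polar _
    ((show Measurable fun x => F x * invPow p x by fun_prop).indicator measurableSet_ball),
    ← lintegral_mul_const _ (by fun_prop)]
  refine lintegral_congr fun ω => ?_
  rw [← setLIntegral_Ioo_rpow ha, ← lintegral_const_mul _ (by fun_prop), ← lintegral_indicator
    measurableSet_Ioi, ← lintegral_indicator measurableSet_Ioo]
  refine lintegral_congr fun r => ?_
  by_cases hr : 0 < r
  swap
  · rw [indicator_of_notMem (by simpa using hr), indicator_of_notMem (by simp [hr])]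
  have hω : ‖(ω : EuclideanSpace ℝ (Fin n))‖ = 1 := by simp
  have hω0 : (ω : EuclideanSpace ℝ (Fin n)) ≠ 0 := by
    intro h; simp [h] at hω
  rw [indicator_of_mem (by simpa using hr)]
  by_cases hr1 : r < 1
  · rw [indicator_of_mem (by simp [norm_smul, abs_of_pos hr, hr1]),
      indicator_of_mem (show r ∈ Ioo (0 : ℝ) 1 from ⟨hr, hr1⟩), hom r hr,
      invPow_of_ne_zero _ (smul_ne_zero hr.ne' hω0), norm_smul, hω, mul_one, Real.norm_of_nonneg hr.le]
    -- The radial powers combine to `(n - 1) + q - p = a - 1`.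
    rw [show ENNReal.ofReal (r ^ (Module.finrank ℝ (EuclideanSpace ℝ (Fin n)) - 1)) *
        (ENNReal.ofReal (r ^ q) * F ω * ENNReal.ofReal (r ^ (-p))) =
        F ω * (ENNReal.ofReal (r ^ (Module.finrank ℝ (EuclideanSpace ℝ (Fin n)) - 1)) *
        ENNReal.ofReal (r ^ q) * ENNReal.ofReal (r ^ (-p))) by ring,
      ← ENNReal.ofReal_mul (by positivity), ← ENNReal.ofReal_mul (by positivity),
      ← Real.rpow_natCast, ← Real.rpow_add hr, ← Real.rpow_add hr, finrank_euclideanSpace_fin,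
      Nat.cast_sub (Nat.one_le_iff_ne_zero.2 hn)]
    congr 3
    push_cast
    linarith
  · rw [indicator_of_notMem (by simpa [norm_smul, abs_of_pos hr] using hr1),
      indicator_of_notMem (fun h => hr1 h.2), mul_zero]

open Metric in
theorem setLIntegral_ball_invPow (hn : n ≠ 0) {p : ℝ} (hp : p < n) :
    ∫⁻ x in ball (0 : EuclideanSpace ℝ (Fin n)) 1, invPow p x =
      (volume : Measure (EuclideanSpace ℝ (Fin n))).toSphere Set.univ *
        (ENNReal.ofReal (n - p))⁻¹ := by
  have := setLIntegral_ball_mul_invPow hn (F := fun _ => 1) measurable_const (q := 0) (p := p)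
    (a := n - p) (by linarith) (by ring) (by simp)
  simpa using this

open Metric in
theorem setLIntegral_ball_invPow_lt_top (hn : n ≠ 0) {p : ℝ} (hp : p < n) :
    ∫⁻ x in ball (0 : EuclideanSpace ℝ (Fin n)) 1, invPow p x < ∞ := by
  rw [setLIntegral_ball_invPow hn hp]
  refine ENNReal.mul_lt_top (measure_lt_top _ _) ?_
  simpa using hp

-- Off the unit ball `1 + ‖x‖ ≤ 2 ‖x‖`, which gives comparison with the integrable `(1 + ‖x‖) ^
-- (-p)`.
open Metric in
theorem setLIntegral_compl_ball_invPow_lt_top {p : ℝ} (hp : (n : ℝ) < p) :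
    ∫⁻ x in (ball (0 : EuclideanSpace ℝ (Fin n)) 1)ᶜ, invPow p x < ∞ := by
  have hfin := finite_integral_one_add_norm (μ := (volume : Measure (EuclideanSpace ℝ (Fin n))))
    (r := p) (by simpa using hp)
  have hp0 : 0 < p := (Nat.cast_nonneg n).trans_lt hp
  calc ∫⁻ x in (ball (0 : EuclideanSpace ℝ (Fin n)) 1)ᶜ, invPow p x
      ≤ ∫⁻ x in (ball (0 : EuclideanSpace ℝ (Fin n)) 1)ᶜ,
        ENNReal.ofReal (2 ^ p) * ENNReal.ofReal ((1 + ‖x‖) ^ (-p)) := by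
        refine setLIntegral_mono' measurableSet_ball.compl fun x hx => ?_
        have hx1 : 1 ≤ ‖x‖ := by simpa using hx
        rw [invPow_of_ne_zero _ (norm_pos_iff.1 (by linarith)), ← ENNReal.ofReal_mul (by positivity)]
        refine ENNReal.ofReal_le_ofReal ?_
        rw [Real.rpow_neg (by positivity), Real.rpow_neg (by positivity), ← div_eq_mul_inv,
          inv_eq_one_div, div_le_div_iff₀ (by positivity) (by positivity), one_mul,
          ← Real.mul_rpow (by positivity) (by positivity)]
        exact Real.rpow_le_rpow (by positivity) (by linarith) hp0.le
    _ ≤ ∫⁻ x, ENNReal.ofReal (2 ^ p) * ENNReal.ofReal ((1 + ‖x‖) ^ (-p)) :=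
        setLIntegral_le_lintegral _ _
    _ < ∞ := by
        rw [lintegral_const_mul _ (by fun_prop)]
        exact ENNReal.mul_lt_top ENNReal.ofReal_lt_top hfin

/-! ### The exact contribution of the linear part -/

/-- Any two vectors of the same length are related by a linear isometry. -/
theorem exists_linearIsometryEquiv_apply_eq {v w : EuclideanSpace ℝ (Fin n)} (h : ‖v‖ = ‖w‖) :
    ∃ T : EuclideanSpace ℝ (Fin n) ≃ₗᵢ[ℝ] EuclideanSpace ℝ (Fin n), T v = w :=
  ⟨_, Submodule.reflection_sub h⟩

-- An isometry carries `‖v‖ • e` to `v`, and homogeneity of degree one leaves the radial integral `1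
-- / (1 - α)`. The identity is exact for each `α`, so no limit is needed in the main term.
open Metric in
theorem setLIntegral_ball_inner_mul_invPow (hn : n ≠ 0) {e : EuclideanSpace ℝ (Fin n)}
    (he : ‖e‖ = 1) (v : EuclideanSpace ℝ (Fin n)) {α : ℝ} (hα : α < 1) :
    ENNReal.ofReal (1 - α) * ∫⁻ x in ball (0 : EuclideanSpace ℝ (Fin n)) 1,
      ENNReal.ofReal |inner ℝ v x| * invPow (n + α) x =
      ENNReal.ofReal (sphereConst e) * ENNReal.ofReal ‖v‖ := by
  obtain ⟨T, hT⟩ : ∃ T : EuclideanSpace ℝ (Fin n) ≃ₗᵢ[ℝ] EuclideanSpace ℝ (Fin n),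
      T (‖v‖ • e) = v := exists_linearIsometryEquiv_apply_eq (by simp [norm_smul, he])
  have hrot : ∫⁻ x in ball (0 : EuclideanSpace ℝ (Fin n)) 1,
      ENNReal.ofReal |inner ℝ v x| * invPow (n + α) x =
      ∫⁻ x in ball (0 : EuclideanSpace ℝ (Fin n)) 1,
        ENNReal.ofReal ‖v‖ * (ENNReal.ofReal |inner ℝ x e| * invPow (n + α) x) := by
    rw [← T.measurePreserving.setLIntegral_comp_preimage measurableSet_ball (by fun_prop)]
    have hpre : T ⁻¹' ball 0 1 = ball 0 1 := by ext; simp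
    rw [hpre]
    refine lintegral_congr fun x => ?_
    conv_lhs => rw [← hT]
    rw [T.inner_map_map, inner_smul_left, real_inner_comm, ← mul_assoc, ← ENNReal.ofReal_mul
      (norm_nonneg v)]
    simp [invPow, abs_mul]
  have hint : Integrable (fun ω : sphere (0 : EuclideanSpace ℝ (Fin n)) 1 =>
      |inner ℝ (ω : EuclideanSpace ℝ (Fin n)) e|)
      (volume : Measure (EuclideanSpace ℝ (Fin n))).toSphere := by
    refine Integrable.of_bound (C := 1) (by fun_prop) (ae_of_all _ fun ω => ?_)
    have := abs_real_inner_le_norm (ω : EuclideanSpace ℝ (Fin n)) e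
    simpa [he] using this
  rw [hrot, lintegral_const_mul _ (by fun_prop),
    setLIntegral_ball_mul_invPow hn (F := fun x => ENNReal.ofReal |inner ℝ x e|) (q := 1)
      (a := 1 - α) (by fun_prop) (by linarith) (by ring), sphereConst,
    ofReal_integral_eq_lintegral_ofReal hint (ae_of_all _ fun _ => abs_nonneg _)]
  · have h0 : ENNReal.ofReal (1 - α) ≠ 0 := by simpa using hα
    rw [show ∀ a b c d : ℝ≥0∞, a * (b * (c * d)) = (a * d) * (c * b) by intros; ring,
      ENNReal.mul_inv_cancel h0 ENNReal.ofReal_ne_top, one_mul]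
  · intro r hr x
    rw [inner_smul_left, Real.rpow_one, ← ENNReal.ofReal_mul hr.le]
    simp [abs_mul, abs_of_pos hr]

/-! ### Almost everywhere finiteness of Riesz potentials -/

/-- The Riesz kernels of order `α ∈ [a, n]` are dominated by the one of order `a` plus one. -/
theorem invPow_le_add_one {p q : ℝ} (hp : 0 ≤ p) (hpq : p ≤ q)
    {x : EuclideanSpace ℝ (Fin n)} (hx : x ≠ 0) : invPow p x ≤ invPow q x + 1 := by
  have hx0 : 0 < ‖x‖ := norm_pos_iff.2 hx
  rw [invPow_of_ne_zero _ hx, invPow_of_ne_zero _ hx]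
  rcases le_total ‖x‖ 1 with h | h
  · exact le_add_right (ENNReal.ofReal_le_ofReal
      (Real.rpow_le_rpow_of_exponent_ge hx0 h (by linarith)))
  · refine le_add_left ?_
    rw [← ENNReal.ofReal_one]
    exact ENNReal.ofReal_le_ofReal (Real.rpow_le_one_of_one_le_of_nonpos h (by linarith))

-- The bound is uniform in `y`: the part with `‖x - y‖ < 1` is translated to the origin, and
-- elsewhere the kernel is at most `1`.
open Metric in
theorem setLIntegral_ball_invPow_sub_le {p : ℝ} (hp : 0 ≤ p) (R : ℝ)
    (y : EuclideanSpace ℝ (Fin n)) :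
    ∫⁻ x in ball (0 : EuclideanSpace ℝ (Fin n)) R, invPow p (x - y) ≤
      (∫⁻ x in ball (0 : EuclideanSpace ℝ (Fin n)) 1, invPow p x) +
        volume (ball (0 : EuclideanSpace ℝ (Fin n)) R) := by
  have hpt : ∀ x, (ball (0 : EuclideanSpace ℝ (Fin n)) R).indicator
      (fun x => invPow p (x - y)) x ≤
      (ball (0 : EuclideanSpace ℝ (Fin n)) 1).indicator (invPow p) (x - y) +
        (ball (0 : EuclideanSpace ℝ (Fin n)) R).indicator 1 x := by
    intro x
    by_cases hx : x ∈ ball (0 : EuclideanSpace ℝ (Fin n)) R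
    · rw [Set.indicator_of_mem hx, Set.indicator_of_mem hx]
      by_cases hxy : x - y ∈ ball (0 : EuclideanSpace ℝ (Fin n)) 1
      · rw [Set.indicator_of_mem hxy]
        exact le_self_add
      · have h1 : 1 ≤ ‖x - y‖ := by simpa using hxy
        refine le_add_left ?_
        rw [invPow_of_ne_zero _ (norm_pos_iff.1 (by linarith)), Pi.one_apply, ← ENNReal.ofReal_one]
        exact ENNReal.ofReal_le_ofReal (Real.rpow_le_one_of_one_le_of_nonpos h1 (by linarith))
    · rw [Set.indicator_of_notMem hx]
      exact zero_le
  rw [← lintegral_indicator measurableSet_ball, ← lintegral_indicator measurableSet_ball]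
  refine (lintegral_mono hpt).trans_eq ?_
  rw [lintegral_add_right _ (measurable_one.indicator measurableSet_ball),
    lintegral_sub_right_eq_self (fun x => (ball (0 : EuclideanSpace ℝ (Fin n)) 1).indicator
      (invPow p) x) y, lintegral_indicator_one measurableSet_ball]

open Metric in
/-- Riesz potentials of integrable functions are finite almost everywhere. -/
theorem ae_lintegral_mul_invPow_add_one_lt_top (hn : n ≠ 0) {p : ℝ} (hp : 0 ≤ p) (hpn : p < n)
    {G : EuclideanSpace ℝ (Fin n) → ℝ≥0∞} (hG : Measurable G) (hGint : ∫⁻ y, G y < ∞) :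
    ∀ᵐ x : EuclideanSpace ℝ (Fin n), ∫⁻ y, G y * (invPow p (x - y) + 1) < ∞ := by
  -- By Tonelli the potential has finite integral over each ball; the balls exhaust the space.
  have hloc : ∀ R : ℕ, ∀ᵐ x ∂(volume.restrict (ball (0 : EuclideanSpace ℝ (Fin n)) R)),
      ∫⁻ y, G y * (invPow p (x - y) + 1) < ∞ := by
    intro R
    refine ae_lt_top (by fun_prop) (ne_of_lt ?_)
    rw [lintegral_lintegral_swap (by fun_prop)]
    calc ∫⁻ y, ∫⁻ x in ball (0 : EuclideanSpace ℝ (Fin n)) R, G y * (invPow p (x - y) + 1)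
        ≤ ∫⁻ y, G y * ((∫⁻ x in ball (0 : EuclideanSpace ℝ (Fin n)) 1, invPow p x) +
          volume (ball (0 : EuclideanSpace ℝ (Fin n)) R) +
          volume (ball (0 : EuclideanSpace ℝ (Fin n)) R)) := by
          refine lintegral_mono fun y => ?_
          rw [lintegral_const_mul _ (by fun_prop), lintegral_add_right _ measurable_const,
            lintegral_one, Measure.restrict_apply_univ]
          gcongr
          exact setLIntegral_ball_invPow_sub_le hp R y
      _ < ∞ := by
          rw [lintegral_mul_const _ hG]
          have := setLIntegral_ball_invPow_lt_top hn hpn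
          have h2 : volume (ball (0 : EuclideanSpace ℝ (Fin n)) R) < ∞ := measure_ball_lt_top
          exact ENNReal.mul_lt_top hGint (by simp [this, h2])
  have := (ae_restrict_iUnion_iff (μ := volume)
    (fun R : ℕ => ball (0 : EuclideanSpace ℝ (Fin n)) R) _).2 hloc
  rwa [iUnion_ball_nat, Measure.restrict_univ] at this

/-! ### Translations and first-order expansion in `L¹` -/

/-- Translation is continuous in `L¹`. -/
theorem tendsto_lintegral_enorm_comp_add_sub {E F : Type*} [NormedAddCommGroup E]
    [NormedSpace ℝ E] [FiniteDimensional ℝ E] [MeasurableSpace E] [BorelSpace E]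
    (μ : Measure E) [μ.IsAddHaarMeasure] [NormedAddCommGroup F] {g : E → F} (hg : Integrable g μ) :
    Tendsto (fun h : E => ∫⁻ x, ‖g (x + h) - g x‖ₑ ∂μ) (𝓝 0) (𝓝 0) := by
  have hp : MemLp g 1 μ := memLp_one_iff_integrable.2 hg
  have : Fact ((1 : ℝ≥0∞) ≠ ∞) := ⟨ENNReal.one_ne_top⟩
  have hcont : Continuous fun h : E => DomAddAct.mk h +ᵥ hp.toLp g :=
    (DomAddAct.continuous_mk).vadd continuous_const
  have h1 : Tendsto (fun h : E => edist (DomAddAct.mk h +ᵥ hp.toLp g) (hp.toLp g)) (𝓝 0) (𝓝 0) := by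
    have := (hcont.edist continuous_const).tendsto' (x := 0) (y := 0)
      (f := fun h : E => edist (DomAddAct.mk h +ᵥ hp.toLp g) (hp.toLp g)) (by simp)
    exact this
  refine h1.congr fun h => ?_
  rw [DomAddAct.mk_vadd_toLp, Lp.edist_toLp_toLp, eLpNorm_one_eq_lintegral_enorm]
  refine lintegral_congr fun x => ?_
  simp [add_comm]

/-- Supplies Fubini along segments. Strong measurability makes the composition with `(x, t) ↦ x + t
• h` measurable, and translation invariance makes the `x`-integral independent of `t`. -/
theorem integrable_prod_comp_add_smul {F : Type*} [NormedAddCommGroup F]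
    {g : EuclideanSpace ℝ (Fin n) → F} (hgm : StronglyMeasurable g) (hg : Integrable g)
    (h : EuclideanSpace ℝ (Fin n)) :
    Integrable (fun p : EuclideanSpace ℝ (Fin n) × ℝ => g (p.1 + p.2 • h))
      (volume.prod (volume.restrict (Set.Ioc (0 : ℝ) 1))) := by
  have hm : Measurable fun p : EuclideanSpace ℝ (Fin n) × ℝ => p.1 + p.2 • h := by fun_prop
  refine (integrable_prod_iff' (hgm.comp_measurable hm).aestronglyMeasurable).2 ?_
  refine ⟨ae_of_all _ fun t => hg.comp_add_right (t • h), ?_⟩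
  have hconst (t : ℝ) : ∫ x, ‖g (x + t • h)‖ = ∫ x, ‖g x‖ :=
    integral_add_right_eq_self (fun x => ‖g x‖) (t • h)
  simp only [Function.comp_apply, hconst]
  exact integrable_const _

theorem hasDerivAt_comp_sub_smul {φ : EuclideanSpace ℝ (Fin n) → ℝ} (hφ : Differentiable ℝ φ)
    (x h : EuclideanSpace ℝ (Fin n)) (t : ℝ) :
    HasDerivAt (fun t : ℝ => φ (x - t • h)) (-(fderiv ℝ φ (x - t • h) h)) t := by
  have h1 : HasDerivAt (fun t : ℝ => x - t • h) (-h) t := by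
    simpa using ((hasDerivAt_id t).smul_const h).const_sub x
  rw [← map_neg]
  exact (hφ (x - t • h)).hasFDerivAt.comp_hasDerivAt t h1

/-- The weak gradient is tested against the translate `φ (· - a)`, and the shift is then moved onto
`g`. -/
theorem integral_mul_fderiv_comp_sub {f : EuclideanSpace ℝ (Fin n) → ℝ}
    {g : EuclideanSpace ℝ (Fin n) → EuclideanSpace ℝ (Fin n)} (hw : IsWeakGradient f g)
    {φ : EuclideanSpace ℝ (Fin n) → ℝ} (hφ : ContDiff ℝ ((⊤ : ℕ∞) : WithTop ℕ∞) φ)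
    (hφc : HasCompactSupport φ) (a v : EuclideanSpace ℝ (Fin n)) :
    ∫ x, f x * fderiv ℝ φ (x - a) v = - ∫ x, φ x * inner ℝ (g (x + a)) v := by
  have hψ := hw.integral_by_parts (fun x => φ (x - a)) (hφ.comp (contDiff_id.sub contDiff_const))
    (hφc.comp_homeomorph (Homeomorph.subRight a)) v
  simp only [fderiv_comp_sub] at hψ
  rw [hψ, ← integral_add_right_eq_self (fun x => φ (x - a) * inner ℝ (g x) v) a]
  simp

/-- The fundamental theorem of calculus along a fixed translation for `W^{1,1}` functions. -/
theorem ae_sub_eq_integral_inner {f : EuclideanSpace ℝ (Fin n) → ℝ} (hf : Integrable f)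
    {g : EuclideanSpace ℝ (Fin n) → EuclideanSpace ℝ (Fin n)} (hw : IsWeakGradient f g)
    (hg : Integrable g) (hgm : StronglyMeasurable g) (h : EuclideanSpace ℝ (Fin n)) :
    ∀ᵐ x, f (x + h) - f x = ∫ t in Set.Ioc (0 : ℝ) 1, inner ℝ (g (x + t • h)) h := by
  have hgi : Integrable (fun p : EuclideanSpace ℝ (Fin n) × ℝ => inner ℝ (g (p.1 + p.2 • h)) h)
      (volume.prod (volume.restrict (Set.Ioc (0 : ℝ) 1))) :=
    (integrable_prod_comp_add_smul hgm hg h).inner_const h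
  refine ae_eq_of_integral_contDiff_smul_eq ((hf.comp_add_right h).sub hf).locallyIntegrable
    hgi.integral_prod_left.locallyIntegrable fun φ hφ hφc => ?_
  have hφd : Differentiable ℝ φ := hφ.differentiable (by simp)
  have hφ' : Continuous (fderiv ℝ φ) := hφ.continuous_fderiv (by simp)
  obtain ⟨C, hC⟩ := hφc.exists_bound_of_continuous hφ.continuous
  obtain ⟨C', hC'⟩ := (hφc.fderiv ℝ).exists_bound_of_continuous hφ'
  have hφf : Integrable fun x => φ x * f x :=
    hf.bdd_mul hφ.continuous.aestronglyMeasurable (ae_of_all _ hC)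
  have hφf1 : Integrable fun x => φ x * f (x + h) :=
    (hf.comp_add_right h).bdd_mul hφ.continuous.aestronglyMeasurable (ae_of_all _ hC)
  have hφf2 : Integrable fun x => φ (x - h) * f x :=
    hf.bdd_mul (by fun_prop) (ae_of_all _ fun x => hC _)
  have hfi : Integrable (Function.uncurry fun (x : EuclideanSpace ℝ (Fin n)) (t : ℝ) =>
      f x * fderiv ℝ φ (x - t • h) h) (volume.prod (volume.restrict (Set.Ioc (0 : ℝ) 1))) := by
    refine (hf.comp_fst (volume.restrict (Set.Ioc (0 : ℝ) 1))).mul_bdd (c := C' * ‖h‖) ?_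
      (ae_of_all _ fun p => ?_)
    · exact Continuous.aestronglyMeasurable (by fun_prop)
    · exact (ContinuousLinearMap.le_opNorm _ _).trans
        (mul_le_mul_of_nonneg_right (hC' _) (norm_nonneg _))
  have hφg : Integrable (Function.uncurry fun (x : EuclideanSpace ℝ (Fin n)) (t : ℝ) =>
      φ x * inner ℝ (g (x + t • h)) h) (volume.prod (volume.restrict (Set.Ioc (0 : ℝ) 1))) :=
    hgi.bdd_mul (c := C) (hφ.continuous.comp continuous_fst).aestronglyMeasurable
      (ae_of_all _ fun p => hC _)
  -- The classical theorem is applied to the smooth test function; Fubini and the weak gradient then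
  -- transfer it to `f`.
  have hFTC : ∀ x, φ (x - h) - φ x = -∫ t in Set.Ioc (0 : ℝ) 1, fderiv ℝ φ (x - t • h) h := by
    intro x
    rw [← integral_neg, ← intervalIntegral.integral_of_le zero_le_one,
      intervalIntegral.integral_eq_sub_of_hasDerivAt
        (fun t _ => hasDerivAt_comp_sub_smul hφd x h t)]
    · simp
    · exact Continuous.intervalIntegrable (by fun_prop) _ _
  simp only [smul_eq_mul]
  calc ∫ x, φ x * (f (x + h) - f x)
      = (∫ x, φ x * f (x + h)) - ∫ x, φ x * f x := by
        rw [← integral_sub hφf1 hφf]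
        simp only [mul_sub]
    _ = (∫ x, φ (x - h) * f x) - ∫ x, φ x * f x := by
        rw [← integral_add_right_eq_self (fun x => φ (x - h) * f x) h]
        simp
    _ = ∫ x, (φ (x - h) - φ x) * f x := by
        rw [← integral_sub hφf2 hφf]
        simp only [sub_mul]
    _ = -∫ x, ∫ t in Set.Ioc (0 : ℝ) 1, f x * fderiv ℝ φ (x - t • h) h := by
        rw [← integral_neg]
        refine integral_congr_ae (ae_of_all _ fun x => ?_)
        simp only
        rw [hFTC, integral_const_mul]
        ring
    _ = -∫ t in Set.Ioc (0 : ℝ) 1, -∫ x, φ x * inner ℝ (g (x + t • h)) h := by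
        rw [integral_integral_swap hfi]
        simp only [integral_mul_fderiv_comp_sub hw hφ hφc]
    _ = ∫ x, ∫ t in Set.Ioc (0 : ℝ) 1, φ x * inner ℝ (g (x + t • h)) h := by
        rw [integral_neg, neg_neg, integral_integral_swap hφg]
    _ = ∫ x, φ x * ∫ t in Set.Ioc (0 : ℝ) 1, inner ℝ (g (x + t • h)) h := by
        simp only [integral_const_mul]

/-- The defect equals `∫₀¹ ⟪g (x + t h) - g x, h⟫ dt` for a.e. `x`; Cauchy–Schwarz and Tonelli give
the bound. -/
theorem lintegral_enorm_sub_sub_inner_le {f : EuclideanSpace ℝ (Fin n) → ℝ} (hf : Integrable f)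
    {g : EuclideanSpace ℝ (Fin n) → EuclideanSpace ℝ (Fin n)} (hw : IsWeakGradient f g)
    (hg : Integrable g) (hgm : StronglyMeasurable g) (h : EuclideanSpace ℝ (Fin n)) :
    ∫⁻ x, ‖f (x + h) - f x - inner ℝ (g x) h‖ₑ ≤
      (∫⁻ t in Set.Ioc (0 : ℝ) 1, ∫⁻ x, ‖g (x + t • h) - g x‖ₑ) * ‖h‖ₑ := by
  have hgi := integrable_prod_comp_add_smul hgm hg h
  have hm : Measurable fun p : EuclideanSpace ℝ (Fin n) × ℝ => g (p.1 + p.2 • h) := by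
    have := hgm.measurable
    fun_prop
  have hm1 : Measurable fun p : EuclideanSpace ℝ (Fin n) × ℝ => g p.1 :=
    hgm.measurable.comp measurable_fst
  rw [lintegral_lintegral_swap (by fun_prop), ← lintegral_mul_const' _ _ enorm_ne_top]
  refine lintegral_mono_ae ?_
  filter_upwards [ae_sub_eq_integral_inner hf hw hg hgm h, hgi.prod_right_ae] with x hx hxi
  have hsub : f (x + h) - f x - inner ℝ (g x) h =
      ∫ t in Set.Ioc (0 : ℝ) 1, inner ℝ (g (x + t • h) - g x) h := by
    simp only [inner_sub_left]
    rw [integral_sub (hxi.inner_const h) (integrable_const _), hx]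
    simp
  rw [hsub, ← lintegral_mul_const' _ _ enorm_ne_top]
  refine (enorm_integral_le_lintegral_enorm _).trans (lintegral_mono fun t => ?_)
  simp only [enorm_eq_nnnorm, ← ENNReal.coe_mul]
  exact ENNReal.coe_le_coe.2 (nnnorm_inner_le_nnnorm _ _)

theorem lintegral_enorm_comp_add_sub_le {E F : Type*} [NormedAddCommGroup E] [MeasurableSpace E]
    [BorelSpace E] {μ : Measure E} [μ.IsAddRightInvariant] [NormedAddCommGroup F] {g : E → F}
    (hg : AEStronglyMeasurable g μ) (h : E) :
    ∫⁻ x, ‖g (x + h) - g x‖ₑ ∂μ ≤ 2 * ∫⁻ x, ‖g x‖ₑ ∂μ := by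
  calc ∫⁻ x, ‖g (x + h) - g x‖ₑ ∂μ ≤ ∫⁻ x, (‖g (x + h)‖ₑ + ‖g x‖ₑ) ∂μ :=
        lintegral_mono fun x => enorm_sub_le
    _ = 2 * ∫⁻ x, ‖g x‖ₑ ∂μ := by
        rw [lintegral_add_right' _ hg.enorm, lintegral_add_right_eq_self (fun x => ‖g x‖ₑ), two_mul]

/-! ### Comparison of the fractional derivative with the gradient -/

theorem fracDeriv_eq_lintegral_invPow (α : ℝ) (f : EuclideanSpace ℝ (Fin n) → ℝ)
    (x : EuclideanSpace ℝ (Fin n)) :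
    fracDeriv α f x = ∫⁻ h, ‖f (x + h) - f x‖ₑ * invPow (n + α) h := by
  rw [fracDeriv, ← lintegral_add_left_eq_self _ x]
  refine lintegral_congr fun h => ?_
  rw [div_eq_mul_inv, invPow, abs_sub_comm, ← Real.norm_eq_abs, ofReal_norm]
  simp

/-- The linear functional `⟪v, ·⟫` truncated to the unit ball. -/
noncomputable def truncInner (v h : EuclideanSpace ℝ (Fin n)) : ℝ :=
  (Metric.ball (0 : EuclideanSpace ℝ (Fin n)) 1).indicator (fun _ => (1 : ℝ)) h * inner ℝ v h

@[fun_prop]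
theorem _root_.Measurable.truncInner {β : Type*} [MeasurableSpace β]
    {u v : β → EuclideanSpace ℝ (Fin n)} (hu : Measurable u) (hv : Measurable v) :
    Measurable fun b => truncInner (u b) (v b) := by
  have hχ : Measurable ((Metric.ball (0 : EuclideanSpace ℝ (Fin n)) 1).indicator
    (fun _ => (1 : ℝ))) := measurable_const.indicator measurableSet_ball
  unfold RieszBBM.truncInner
  fun_prop

theorem truncInner_of_mem {v h : EuclideanSpace ℝ (Fin n)}
    (hh : h ∈ Metric.ball (0 : EuclideanSpace ℝ (Fin n)) 1) : truncInner v h = inner ℝ v h := by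
  simp only [truncInner, Set.indicator_of_mem hh, one_mul]

theorem truncInner_of_notMem {v h : EuclideanSpace ℝ (Fin n)}
    (hh : h ∉ Metric.ball (0 : EuclideanSpace ℝ (Fin n)) 1) : truncInner v h = 0 := by
  simp only [truncInner, Set.indicator_of_notMem hh, zero_mul]

theorem lintegral_truncInner_mul_invPow (hn : n ≠ 0) {e : EuclideanSpace ℝ (Fin n)}
    (he : ‖e‖ = 1) (v : EuclideanSpace ℝ (Fin n)) {α : ℝ} (hα : α < 1) :
    ENNReal.ofReal (1 - α) * ∫⁻ h, ‖truncInner v h‖ₑ * invPow (n + α) h =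
      ENNReal.ofReal (sphereConst e) * ENNReal.ofReal ‖v‖ := by
  rw [← setLIntegral_ball_inner_mul_invPow hn he v hα, ← lintegral_indicator measurableSet_ball]
  congr 1
  refine lintegral_congr fun h => ?_
  by_cases hh : h ∈ Metric.ball (0 : EuclideanSpace ℝ (Fin n)) 1
  · rw [truncInner_of_mem hh, Set.indicator_of_mem hh, ← ofReal_norm, Real.norm_eq_abs]
  · rw [truncInner_of_notMem hh, Set.indicator_of_notMem hh, enorm_zero, zero_mul]

/-- The rescaled defect between the difference quotients of `f` and its linearization with
gradient `g`. -/
noncomputable def remainder (α : ℝ) (f : EuclideanSpace ℝ (Fin n) → ℝ)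
    (g : EuclideanSpace ℝ (Fin n) → EuclideanSpace ℝ (Fin n)) (x : EuclideanSpace ℝ (Fin n)) :
    ℝ≥0∞ :=
  ENNReal.ofReal (1 - α) *
    ∫⁻ h, ‖f (x + h) - f x - truncInner (g x) h‖ₑ * invPow (n + α) h

section

variable {f : EuclideanSpace ℝ (Fin n) → ℝ}
  {g : EuclideanSpace ℝ (Fin n) → EuclideanSpace ℝ (Fin n)}

theorem measurable_remainder_integrand (hfm : Measurable f) (hgm : Measurable g) (α : ℝ) :
    Measurable fun p : EuclideanSpace ℝ (Fin n) × EuclideanSpace ℝ (Fin n) =>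
      ‖f (p.1 + p.2) - f p.1 - truncInner (g p.1) p.2‖ₑ * invPow (n + α) p.2 := by
  fun_prop

theorem measurable_remainder (hfm : Measurable f) (hgm : Measurable g) (α : ℝ) :
    Measurable (remainder α f g) :=
  (measurable_remainder_integrand hfm hgm α).lintegral_prod_right'.const_mul _

theorem measurable_fracDeriv (hfm : Measurable f) (α : ℝ) : Measurable (fracDeriv α f) := by
  unfold fracDeriv
  refine Measurable.lintegral_prod_right' (f := fun p : EuclideanSpace ℝ (Fin n) ×
    EuclideanSpace ℝ (Fin n) => ENNReal.ofReal |f p.1 - f p.2| /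
      ENNReal.ofReal (‖p.1 - p.2‖ ^ ((n : ℝ) + α))) ?_
  fun_prop

/-- This bound and its converse below are the triangle inequality under the integral. They are kept
one-sided because subtraction in `[0, ∞]` is truncated. -/
theorem fracDeriv_le_add_remainder (hn : n ≠ 0) {e : EuclideanSpace ℝ (Fin n)}
    (he : ‖e‖ = 1) {α : ℝ} (hα : α < 1) (x : EuclideanSpace ℝ (Fin n)) :
    ENNReal.ofReal (1 - α) * fracDeriv α f x ≤
      ENNReal.ofReal (sphereConst e) * ENNReal.ofReal ‖g x‖ + remainder α f g x := by
  rw [← lintegral_truncInner_mul_invPow hn he _ hα, remainder, ← mul_add,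
    ← lintegral_add_left (by fun_prop), fracDeriv_eq_lintegral_invPow]
  gcongr with h
  rw [← add_mul]
  gcongr
  refine le_trans (le_of_eq ?_) (enorm_add_le _ _)
  congr 1
  ring

theorem le_fracDeriv_add_remainder (hn : n ≠ 0) (hfm : Measurable f) {e : EuclideanSpace ℝ (Fin n)}
    (he : ‖e‖ = 1) {α : ℝ} (hα : α < 1) (x : EuclideanSpace ℝ (Fin n)) :
    ENNReal.ofReal (sphereConst e) * ENNReal.ofReal ‖g x‖ ≤
      ENNReal.ofReal (1 - α) * fracDeriv α f x + remainder α f g x := by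
  rw [← lintegral_truncInner_mul_invPow hn he _ hα, remainder, fracDeriv_eq_lintegral_invPow,
    ← mul_add, ← lintegral_add_left (by fun_prop)]
  gcongr with h
  rw [← add_mul]
  gcongr
  refine le_trans (le_of_eq ?_) (enorm_sub_le)
  congr 1
  ring

end

/-! ### Vanishing of the remainder in `L¹` -/

open Metric in
/-- The kernels `(1 - α) ‖h‖ ^ (1 - n - α)` on the unit ball concentrate at the origin. -/
theorem tendsto_ofReal_mul_setLIntegral_ball {ι : Type*} {l : Filter ι} (hn : n ≠ 0) {α : ι → ℝ}
    (hα : ∀ k, α k < 1) (hlim : Tendsto α l (𝓝 1)) {Ω : EuclideanSpace ℝ (Fin n) → ℝ≥0∞}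
    {G : ℝ≥0∞} (hG : G ≠ ∞) (hΩG : ∀ h, Ω h ≤ G) (hΩ : Tendsto Ω (𝓝 0) (𝓝 0)) :
    Tendsto (fun k => ENNReal.ofReal (1 - α k) *
      ∫⁻ h in ball (0 : EuclideanSpace ℝ (Fin n)) 1, Ω h * invPow (n + α k - 1) h) l (𝓝 0) := by
  set S := (volume : Measure (EuclideanSpace ℝ (Fin n))).toSphere Set.univ with hS
  have hStop : S ≠ ∞ := measure_ne_top _ _
  rw [ENNReal.tendsto_nhds_zero]
  intro ε hε
  -- The kernel `(1 - α) ‖h‖ ^ (1 - n - α)` has mass exactly `S` on the unit ball, so the part near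
  -- the origin costs at most `S * η ≤ ε / 2`.
  set η := ε / 2 / S with hη
  have hη0 : 0 < η := ENNReal.div_pos (ENNReal.half_pos hε.ne').ne' hStop
  obtain ⟨δ', hδ'0, hδ'⟩ := Metric.eventually_nhds_iff.1 ((ENNReal.tendsto_nhds_zero.1 hΩ) η hη0)
  set δ := min δ' 1
  have hδ0 : 0 < δ := lt_min hδ'0 one_pos
  -- For `δ ≤ ‖h‖` the kernel is at most `δ ^ (-n)` uniformly in `α ∈ [0, 1)`; this uses `δ ≤ 1`.
  set C := G * ENNReal.ofReal (δ ^ (-(n : ℝ))) * volume (ball (0 : EuclideanSpace ℝ (Fin n)) 1)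
  have hC : C ≠ ∞ := ENNReal.mul_ne_top (ENNReal.mul_ne_top hG ENNReal.ofReal_ne_top)
    measure_ball_lt_top.ne
  have hlimC : Tendsto (fun k => ENNReal.ofReal (1 - α k) * C) l (𝓝 0) := by
    have h1 : Tendsto (fun k => ENNReal.ofReal (1 - α k)) l (𝓝 0) := by
      have := ENNReal.tendsto_ofReal (hlim.const_sub 1)
      simpa using this
    simpa using ENNReal.Tendsto.mul_const h1 (Or.inr hC)
  filter_upwards [(ENNReal.tendsto_nhds_zero.1 hlimC) (ε / 2) (ENNReal.half_pos hε.ne'),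
    hlim.eventually_const_le zero_lt_one] with k hk hk0
  have h1k : ENNReal.ofReal (1 - α k) ≠ 0 := by simpa using hα k
  calc ENNReal.ofReal (1 - α k) *
      ∫⁻ h in ball (0 : EuclideanSpace ℝ (Fin n)) 1, Ω h * invPow (n + α k - 1) h
      ≤ ENNReal.ofReal (1 - α k) * ∫⁻ h in ball (0 : EuclideanSpace ℝ (Fin n)) 1,
          (η * invPow (n + α k - 1) h + G * ENNReal.ofReal (δ ^ (-(n : ℝ)))) := by
        gcongr ENNReal.ofReal (1 - α k) * ?_
        refine setLIntegral_mono' measurableSet_ball fun h hh => ?_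
        rcases lt_or_ge ‖h‖ δ with hlt | hge
        · refine le_add_right ?_
          gcongr
          exact hδ' (by simpa using hlt.trans_le (min_le_left _ _))
        · refine le_add_left ?_
          have hh0 : 0 < ‖h‖ := hδ0.trans_le hge
          gcongr
          · exact hΩG h
          · rw [invPow_of_ne_zero _ (norm_pos_iff.1 hh0)]
            refine ENNReal.ofReal_le_ofReal ?_
            have hn1 : (1 : ℝ) ≤ n := by exact_mod_cast Nat.one_le_iff_ne_zero.2 hn
            exact (Real.rpow_le_rpow_of_nonpos hδ0 hge (by linarith)).trans
              (Real.rpow_le_rpow_of_exponent_ge hδ0 (min_le_right _ _) (by linarith [hα k]))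
    _ = S * η + ENNReal.ofReal (1 - α k) * C := by
        rw [lintegral_add_right _ measurable_const, lintegral_const_mul _ (by fun_prop),
          setLIntegral_ball_invPow hn (by linarith [hα k]), mul_add, setLIntegral_const]
        congr 1
        rw [show (n : ℝ) - (n + α k - 1) = 1 - α k by ring, ← hS,
          show ∀ a b c d : ℝ≥0∞, a * (b * (c * d)) = (a * d) * (c * b) by intros; ring,
          ENNReal.mul_inv_cancel h1k ENNReal.ofReal_ne_top, one_mul]
    _ ≤ ε / 2 + ε / 2 := add_le_add ENNReal.mul_div_le hk
    _ = ε := ENNReal.add_halves ε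

theorem tendsto_lintegral_Ioc_comp_smul {D : EuclideanSpace ℝ (Fin n) → ℝ≥0∞}
    (hD : Tendsto D (𝓝 0) (𝓝 0)) :
    Tendsto (fun h => ∫⁻ t in Set.Ioc (0 : ℝ) 1, D (t • h)) (𝓝 0) (𝓝 0) := by
  rw [ENNReal.tendsto_nhds_zero] at hD ⊢
  intro ε hε
  obtain ⟨δ, hδ0, hδ⟩ := Metric.eventually_nhds_iff.1 (hD ε hε)
  refine Metric.eventually_nhds_iff.2 ⟨δ, hδ0, fun h hh => ?_⟩
  calc ∫⁻ t in Set.Ioc (0 : ℝ) 1, D (t • h) ≤ ∫⁻ t in Set.Ioc (0 : ℝ) 1, ε := by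
        refine setLIntegral_mono' measurableSet_Ioc fun t ht => hδ ?_
        rw [dist_zero_right] at hh ⊢
        rw [norm_smul, Real.norm_of_nonneg ht.1.le]
        exact (mul_le_of_le_one_left (norm_nonneg _) ht.2).trans_lt hh
    _ = ε := by simp

open Metric in
theorem tendsto_lintegral_remainder {ι : Type*} {l : Filter ι} (hn : n ≠ 0) {α : ι → ℝ}
    (hα : ∀ k, α k < 1) (hlim : Tendsto α l (𝓝 1))
    {f : EuclideanSpace ℝ (Fin n) → ℝ} (hf : Integrable f) (hfm : StronglyMeasurable f)
    {g : EuclideanSpace ℝ (Fin n) → EuclideanSpace ℝ (Fin n)} (hw : IsWeakGradient f g)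
    (hg : Integrable g) (hgm : StronglyMeasurable g) :
    Tendsto (fun k => ∫⁻ x, remainder (α k) f g x) l (𝓝 0) := by
  set D : EuclideanSpace ℝ (Fin n) → ℝ≥0∞ := fun h => ∫⁻ x, ‖g (x + h) - g x‖ₑ
  set Ω : EuclideanSpace ℝ (Fin n) → ℝ≥0∞ := fun h => ∫⁻ t in Set.Ioc (0 : ℝ) 1, D (t • h)
  have hD : Tendsto D (𝓝 0) (𝓝 0) := tendsto_lintegral_enorm_comp_add_sub volume hg
  have hΩ : Tendsto Ω (𝓝 0) (𝓝 0) := tendsto_lintegral_Ioc_comp_smul hD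
  have hΩG : ∀ h, Ω h ≤ 2 * ∫⁻ x, ‖g x‖ₑ := fun h =>
    (lintegral_mono fun t => lintegral_enorm_comp_add_sub_le hg.1 (t • h)).trans (by simp)
  have hGtop : 2 * ∫⁻ x, ‖g x‖ₑ ≠ ∞ := ENNReal.mul_ne_top ENNReal.ofNat_ne_top hg.2.ne
  -- Once `α ≥ 1/2`, the kernel of exponent `n + 1/2` dominates all those of exponent `n + α`
  -- outside the unit ball, so the far part is at most `(1 - α) A`.
  set A := 2 * (∫⁻ x, ‖f x‖ₑ) *
    ∫⁻ h in (ball (0 : EuclideanSpace ℝ (Fin n)) 1)ᶜ, invPow (n + 1 / 2) h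
  have hA : A ≠ ∞ := ENNReal.mul_ne_top (ENNReal.mul_ne_top ENNReal.ofNat_ne_top hf.2.ne)
    (setLIntegral_compl_ball_invPow_lt_top (by linarith)).ne
  have hlim0 : Tendsto (fun k => ENNReal.ofReal (1 - α k)) l (𝓝 0) := by
    have := ENNReal.tendsto_ofReal (hlim.const_sub 1)
    simpa using this
  have hlimA : Tendsto (fun k => ENNReal.ofReal (1 - α k) * A) l (𝓝 0) := by
    simpa using ENNReal.Tendsto.mul_const hlim0 (Or.inr hA)
  have hsum := (tendsto_ofReal_mul_setLIntegral_ball hn hα hlim hGtop hΩG hΩ).add hlimA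
  rw [add_zero] at hsum
  refine tendsto_of_tendsto_of_tendsto_of_le_of_le' tendsto_const_nhds hsum
    (Eventually.of_forall fun _ => zero_le) ?_
  filter_upwards [hlim.eventually_const_le (show (1 / 2 : ℝ) < 1 by norm_num)] with k hk
  have hmeas := measurable_remainder_integrand hfm.measurable hgm.measurable (α k)
  have hslice (h : EuclideanSpace ℝ (Fin n)) :
      Measurable fun x => f (x + h) - f x - truncInner (g x) h := by
    have := hfm.measurable
    have := hgm.measurable
    fun_prop
  simp only [remainder]
  rw [lintegral_const_mul _ hmeas.lintegral_prod_right', ← mul_add,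
    lintegral_lintegral_swap hmeas.aemeasurable, ← lintegral_add_compl _ measurableSet_ball]
  gcongr ENNReal.ofReal (1 - α k) * (?_ + ?_)
  · refine setLIntegral_mono' measurableSet_ball fun h hh => ?_
    dsimp only
    rw [lintegral_mul_const _ (hslice h).enorm]
    simp only [truncInner_of_mem hh]
    calc _ ≤ Ω h * ‖h‖ₑ * invPow (n + α k) h := by
          gcongr
          exact lintegral_enorm_sub_sub_inner_le hf hw hg hgm h
      _ ≤ Ω h * invPow (n + α k - 1) h := by
          rw [mul_assoc]
          gcongr
          rcases eq_or_ne h 0 with rfl | h0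
          · simp
          · have hpos : 0 < ‖h‖ := norm_pos_iff.2 h0
            rw [invPow_of_ne_zero _ h0, invPow_of_ne_zero _ h0, ← ofReal_norm,
              ← ENNReal.ofReal_mul hpos.le]
            refine ENNReal.ofReal_le_ofReal (le_of_eq ?_)
            nth_rewrite 1 [← Real.rpow_one ‖h‖]
            rw [← Real.rpow_add hpos]
            congr 1
            ring
  · rw [show A = ∫⁻ h in (ball (0 : EuclideanSpace ℝ (Fin n)) 1)ᶜ,
        2 * (∫⁻ x, ‖f x‖ₑ) * invPow (n + 1 / 2) h from (lintegral_const_mul _ (by fun_prop)).symm]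
    refine setLIntegral_mono' measurableSet_ball.compl fun h hh => ?_
    dsimp only
    rw [lintegral_mul_const _ (hslice h).enorm]
    simp only [truncInner_of_notMem hh, sub_zero]
    have h1 : 1 ≤ ‖h‖ := by simpa using hh
    gcongr
    · exact lintegral_enorm_comp_add_sub_le hf.1 h
    · have h0 : h ≠ 0 := norm_pos_iff.1 (by linarith)
      rw [invPow_of_ne_zero _ h0, invPow_of_ne_zero _ h0]
      exact ENNReal.ofReal_le_ofReal (Real.rpow_le_rpow_of_exponent_le h1 (by linarith))

/-! ### Convergence of the potentials along a subsequence -/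

theorem rieszPotential_eq_lintegral_invPow (α : ℝ) (G : EuclideanSpace ℝ (Fin n) → ℝ≥0∞)
    (x : EuclideanSpace ℝ (Fin n)) :
    rieszPotential α G x =
      ENNReal.ofReal (rieszConst n α) * ∫⁻ y, G y * invPow (n - α) (x - y) := by
  simp only [rieszPotential, div_eq_mul_inv, invPow]

/-- Since `n ≥ 2`, the argument `(n - 1) / 2` is positive and so avoids the poles of `Γ`. -/
theorem tendsto_rieszConst_one (hn : 2 ≤ n) :
    Tendsto (rieszConst n) (𝓝 1) (𝓝 (rieszConst n 1)) := by
  have hn' : (2 : ℝ) ≤ n := by exact_mod_cast hn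
  have hG {s : ℝ} (hs : 0 < s) : ContinuousAt Real.Gamma s :=
    (Real.differentiableAt_Gamma fun m => by
      have : (0 : ℝ) ≤ m := Nat.cast_nonneg m
      linarith).continuousAt
  unfold rieszConst
  refine ContinuousAt.div ?_ ?_ ?_
  · exact ContinuousAt.comp (f := fun α : ℝ => ((n : ℝ) - α) / 2) (hG (by linarith)) (by fun_prop)
  · refine ContinuousAt.mul (ContinuousAt.mul ?_ continuousAt_const) ?_
    · exact (Real.continuous_const_rpow two_ne_zero).continuousAt
    · exact ContinuousAt.comp (f := fun α : ℝ => α / 2) (hG (by norm_num)) (by fun_prop)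
  · have := Real.Gamma_pos_of_pos (show (0 : ℝ) < 1 / 2 by norm_num)
    positivity

theorem ae_ne_of_ne_zero (hn : n ≠ 0) (x : EuclideanSpace ℝ (Fin n)) : ∀ᵐ y, x - y ≠ 0 := by
  have := nontrivial_euclideanSpace hn
  filter_upwards [compl_mem_ae_iff.2 (measure_singleton x)] with y hy h
  exact hy (sub_eq_zero.1 h).symm

theorem lintegral_mul_invPow_le (hn : n ≠ 0) {p q : ℝ} (hp : 0 ≤ p) (hpq : p ≤ q)
    (G : EuclideanSpace ℝ (Fin n) → ℝ≥0∞) (x : EuclideanSpace ℝ (Fin n)) :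
    ∫⁻ y, G y * invPow p (x - y) ≤ ∫⁻ y, G y * (invPow q (x - y) + 1) := by
  refine lintegral_mono_ae ?_
  filter_upwards [ae_ne_of_ne_zero hn x] with y hy
  gcongr
  exact invPow_le_add_one hp hpq hy

theorem tendsto_lintegral_mul_invPow (hn : n ≠ 0) {p : ℕ → ℝ} {q r : ℝ} (hp0 : ∀ j, 0 ≤ p j)
    (hpq : ∀ j, p j ≤ q) (hp : Tendsto p atTop (𝓝 r))
    {G : EuclideanSpace ℝ (Fin n) → ℝ≥0∞} (hG : Measurable G) (hGtop : ∀ y, G y ≠ ∞)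
    {x : EuclideanSpace ℝ (Fin n)} (hx : ∫⁻ y, G y * (invPow q (x - y) + 1) ≠ ∞) :
    Tendsto (fun j => ∫⁻ y, G y * invPow (p j) (x - y)) atTop
      (𝓝 (∫⁻ y, G y * invPow r (x - y))) := by
  refine tendsto_lintegral_of_dominated_convergence _ (fun j => by fun_prop) (fun j => ?_) hx ?_
  · filter_upwards [ae_ne_of_ne_zero hn x] with y hy
    gcongr
    exact invPow_le_add_one (hp0 j) (hpq j) hy
  · filter_upwards [ae_ne_of_ne_zero hn x] with y hy
    refine ENNReal.Tendsto.const_mul ?_ (Or.inr (hGtop y))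
    simp only [invPow_of_ne_zero _ hy]
    exact ENNReal.tendsto_ofReal
      ((Real.continuous_const_rpow (norm_ne_zero_iff.2 hy)).continuousAt.tendsto.comp hp.neg)

theorem exists_subseq_tendsto_rieszPotential (hn : 2 ≤ n)
    {f : EuclideanSpace ℝ (Fin n) → ℝ} (hf : Integrable f) (hfm : StronglyMeasurable f)
    {g : EuclideanSpace ℝ (Fin n) → EuclideanSpace ℝ (Fin n)} (hw : IsWeakGradient f g)
    (hg : Integrable g) (hgm : StronglyMeasurable g)
    {e : EuclideanSpace ℝ (Fin n)} (he : ‖e‖ = 1)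
    {α : ℕ → ℝ} (hα : ∀ k, α k < 1) (hlim : Tendsto α atTop (𝓝 1)) :
    ∃ σ : ℕ → ℕ, StrictMono σ ∧
      ∀ᵐ x : EuclideanSpace ℝ (Fin n) ∂volume,
        (∀ j, rieszPotential (α (σ j)) (fracDeriv (α (σ j)) f) x < ∞) ∧
        rieszPotential 1 (fun y => ENNReal.ofReal ‖g y‖) x < ∞ ∧
        Tendsto
          (fun j => ENNReal.ofReal (1 - α (σ j)) *
            rieszPotential (α (σ j)) (fracDeriv (α (σ j)) f) x)
          atTop
          (𝓝 (ENNReal.ofReal (sphereConst e) *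
            rieszPotential 1 (fun y => ENNReal.ofReal ‖g y‖) x)) := by
  have hn0 : n ≠ 0 := by omega
  have hn2 : (2 : ℝ) ≤ n := by exact_mod_cast hn
  have hrem := tendsto_lintegral_remainder hn0 hα hlim hf hfm hw hg hgm
  -- Summable `L¹` norms give a.e. convergence of the potentials; `1/2 ≤ α` gives all kernels the
  -- common majorant of exponent `n - 1/2`.
  obtain ⟨σ, hσ, hσ'⟩ : ∃ σ : ℕ → ℕ, StrictMono σ ∧ ∀ j, 1 / 2 ≤ α (σ j) ∧
      ∫⁻ x, remainder (α (σ j)) f g x ≤ (2 : ℝ≥0∞)⁻¹ ^ j :=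
    extraction_forall_of_eventually fun j =>
      (hlim.eventually_const_le (show (1 / 2 : ℝ) < 1 by norm_num)).and
        (ENNReal.tendsto_nhds_zero.1 hrem _ (ENNReal.pow_pos (by simp) j))
  refine ⟨σ, hσ, ?_⟩
  set K := ENNReal.ofReal (sphereConst e)
  set R : ℕ → EuclideanSpace ℝ (Fin n) → ℝ≥0∞ := fun j => remainder (α (σ j)) f g
  have hRm : ∀ j, Measurable (R j) := fun j => measurable_remainder hfm.measurable hgm.measurable _
  have hDm : ∀ j, Measurable (fracDeriv (α (σ j)) f) := fun j => measurable_fracDeriv hfm.measurable _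
  have hgm' : Measurable fun y => ENNReal.ofReal ‖g y‖ := hgm.measurable.norm.ennreal_ofReal
  have hRint : ∫⁻ y, ∑' j, R j y < ∞ := by
    rw [lintegral_tsum fun j => (hRm j).aemeasurable]
    refine (ENNReal.tsum_le_tsum fun j => (hσ' j).2).trans_lt ?_
    rw [ENNReal.tsum_geometric, ENNReal.one_sub_inv_two, inv_inv]
    exact ENNReal.ofNat_lt_top
  have hgint : ∫⁻ y, ENNReal.ofReal ‖g y‖ < ∞ := by
    simp only [ofReal_norm]
    exact hg.2
  filter_upwards [ae_lintegral_mul_invPow_add_one_lt_top hn0 (p := n - 1 / 2) (by linarith)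
      (by linarith) (Measurable.tsum hRm) hRint,
    ae_lintegral_mul_invPow_add_one_lt_top hn0 (p := n - 1 / 2) (by linarith)
      (by linarith) hgm' hgint] with x hxR hxg
  have hle {j : ℕ} : (0 : ℝ) ≤ n - α (σ j) ∧ (n : ℝ) - α (σ j) ≤ n - 1 / 2 :=
    ⟨by linarith [hα (σ j)], by linarith [(hσ' j).1]⟩
  -- The majorant kernel does not depend on `j`, so `∑ r j` is the potential of `∑ R j`, finite at
  -- this `x`.
  set r : ℕ → ℝ≥0∞ := fun j => ∫⁻ y, R j y * (invPow (n - 1 / 2) (x - y) + 1)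
  have hrsum : ∑' j, r j ≠ ∞ := by
    rw [← lintegral_tsum fun j => by have := hRm j; fun_prop]
    simp only [ENNReal.tsum_mul_right]
    exact hxR.ne
  have hr : Tendsto r atTop (𝓝 0) := ENNReal.tendsto_atTop_zero_of_tsum_ne_top hrsum
  have hRr (j : ℕ) : ∫⁻ y, R j y * invPow (n - α (σ j)) (x - y) ≤ r j :=
    lintegral_mul_invPow_le hn0 hle.1 hle.2 _ x
  set T : ℝ≥0∞ := K * ∫⁻ y, ENNReal.ofReal ‖g y‖ * invPow (n - 1) (x - y)
  have hg1 : ∫⁻ y, ENNReal.ofReal ‖g y‖ * invPow (n - 1) (x - y) < ∞ :=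
    (lintegral_mul_invPow_le hn0 (by linarith) (by linarith) _ x).trans_lt hxg
  have hT : T ≠ ∞ := ENNReal.mul_ne_top ENNReal.ofReal_ne_top hg1.ne
  set t : ℕ → ℝ≥0∞ := fun j => K * ∫⁻ y, ENNReal.ofReal ‖g y‖ * invPow (n - α (σ j)) (x - y)
  have ht : Tendsto t atTop (𝓝 T) :=
    ENNReal.Tendsto.const_mul (tendsto_lintegral_mul_invPow hn0 (fun j => hle.1) (fun j => hle.2)
      ((hlim.comp hσ.tendsto_atTop).const_sub _) hgm' (fun _ => ENNReal.ofReal_ne_top) hxg.ne)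
      (Or.inr ENNReal.ofReal_ne_top)
  have ht_top (j : ℕ) : t j < ∞ := ENNReal.mul_lt_top ENNReal.ofReal_lt_top
    ((lintegral_mul_invPow_le hn0 hle.1 hle.2 _ x).trans_lt hxg)
  set P : ℕ → ℝ≥0∞ := fun j => ∫⁻ y, fracDeriv (α (σ j)) f y * invPow (n - α (σ j)) (x - y)
  have hPt (j : ℕ) : ENNReal.ofReal (1 - α (σ j)) * P j ≤ t j + r j := by
    have hDj := hDm j
    have hRj := hRm j
    calc ENNReal.ofReal (1 - α (σ j)) * P j
        = ∫⁻ y, ENNReal.ofReal (1 - α (σ j)) * fracDeriv (α (σ j)) f y *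
            invPow (n - α (σ j)) (x - y) := by
          rw [← lintegral_const_mul _ (by fun_prop)]
          simp only [mul_assoc]
      _ ≤ ∫⁻ y, (K * (ENNReal.ofReal ‖g y‖ * invPow (n - α (σ j)) (x - y)) +
            R j y * invPow (n - α (σ j)) (x - y)) := by
          refine lintegral_mono fun y => ?_
          rw [← mul_assoc, ← add_mul]
          gcongr
          exact fracDeriv_le_add_remainder hn0 he (hα _) y
      _ ≤ t j + r j := by
          rw [lintegral_add_left (by fun_prop), lintegral_const_mul _ (by fun_prop)]
          gcongr
          exact hRr j
  have htP (j : ℕ) : t j ≤ ENNReal.ofReal (1 - α (σ j)) * P j + r j := by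
    have hDj := hDm j
    have hRj := hRm j
    calc t j = ∫⁻ y, K * ENNReal.ofReal ‖g y‖ * invPow (n - α (σ j)) (x - y) := by
          simp only [t]
          rw [← lintegral_const_mul _ (by fun_prop)]
          simp only [mul_assoc]
      _ ≤ ∫⁻ y, (ENNReal.ofReal (1 - α (σ j)) *
            (fracDeriv (α (σ j)) f y * invPow (n - α (σ j)) (x - y)) +
            R j y * invPow (n - α (σ j)) (x - y)) := by
          refine lintegral_mono fun y => ?_
          rw [← mul_assoc, ← add_mul]
          gcongr
          exact le_fracDeriv_add_remainder hn0 hfm.measurable he (hα _) y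
      _ ≤ ENNReal.ofReal (1 - α (σ j)) * P j + r j := by
          rw [lintegral_add_left (by fun_prop), lintegral_const_mul _ (by fun_prop)]
          gcongr
          exact hRr j
  -- The bound on `(1 - α) P j` passes to `P j` because `1 - α > 0`.
  have hP_top (j : ℕ) : P j < ∞ := by
    refine ENNReal.lt_top_of_mul_ne_top_right ((hPt j).trans_lt ?_).ne (by simpa using hα (σ j))
    exact ENNReal.add_lt_top.2 ⟨ht_top j, (ENNReal.ne_top_of_tsum_ne_top hrsum j).lt_top⟩
  have hPlim : Tendsto (fun j => ENNReal.ofReal (1 - α (σ j)) * P j) atTop (𝓝 T) := by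
    refine tendsto_of_tendsto_of_tendsto_of_le_of_le (g := fun j => t j - r j)
      (h := fun j => t j + r j) ?_ ?_ (fun j => tsub_le_iff_right.2 (htP j)) hPt
    · simpa using ENNReal.Tendsto.sub ht hr (Or.inl hT)
    · simpa using ht.add hr
  simp only [rieszPotential_eq_lintegral_invPow]
  refine ⟨fun j => ENNReal.mul_lt_top ENNReal.ofReal_lt_top (hP_top j),
    ENNReal.mul_lt_top ENNReal.ofReal_lt_top hg1, ?_⟩
  have hconst : Tendsto (fun j => ENNReal.ofReal (rieszConst n (α (σ j)))) atTop
      (𝓝 (ENNReal.ofReal (rieszConst n 1))) :=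
    ENNReal.tendsto_ofReal ((tendsto_rieszConst_one hn).comp (hlim.comp hσ.tendsto_atTop))
  have := ENNReal.Tendsto.mul hconst (Or.inr hT) hPlim (Or.inr ENNReal.ofReal_ne_top)
  rw [mul_left_comm K]
  exact this.congr fun j => mul_left_comm _ _ _

/-! ### Independence of representatives -/

theorem fracDeriv_ae_congr {f f' : EuclideanSpace ℝ (Fin n) → ℝ} (h : f =ᵐ[volume] f') (α : ℝ) :
    fracDeriv α f =ᵐ[volume] fracDeriv α f' := by
  filter_upwards [h] with x hx
  refine lintegral_congr_ae ?_
  filter_upwards [h] with y hy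
  rw [hx, hy]

theorem rieszPotential_congr_ae {G G' : EuclideanSpace ℝ (Fin n) → ℝ≥0∞} (h : G =ᵐ[volume] G')
    (α : ℝ) : rieszPotential α G = rieszPotential α G' := by
  funext x
  rw [rieszPotential, rieszPotential]
  congr 1
  refine lintegral_congr_ae ?_
  filter_upwards [h] with y hy
  rw [hy]

theorem IsWeakGradient.congr_ae {f f' : EuclideanSpace ℝ (Fin n) → ℝ}
    {g g' : EuclideanSpace ℝ (Fin n) → EuclideanSpace ℝ (Fin n)} (hw : IsWeakGradient f g)
    (hf : f =ᵐ[volume] f') (hg : g =ᵐ[volume] g') : IsWeakGradient f' g' where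
  locallyIntegrable_fun := hw.locallyIntegrable_fun.congr hf
  locallyIntegrable_grad := hw.locallyIntegrable_grad.congr hg
  integral_by_parts φ hφ hφc v := by
    rw [← integral_congr_ae (hf.mono fun x hx => by simp only [hx] :
        (fun x => f x * fderiv ℝ φ x v) =ᵐ[volume] fun x => f' x * fderiv ℝ φ x v),
      ← integral_congr_ae (hg.mono fun x hx => by simp only [hx] :
        (fun x => φ x * inner ℝ (g x) v) =ᵐ[volume] fun x => φ x * inner ℝ (g' x) v)]
    exact hw.integral_by_parts φ hφ hφc v

/-- Weak gradients are unique up to null sets. -/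
theorem IsWeakGradient.ae_eq {f : EuclideanSpace ℝ (Fin n) → ℝ}
    {g g' : EuclideanSpace ℝ (Fin n) → EuclideanSpace ℝ (Fin n)} (hw : IsWeakGradient f g)
    (hw' : IsWeakGradient f g') : g =ᵐ[volume] g' := by
  refine ae_eq_of_integral_contDiff_smul_eq hw.locallyIntegrable_grad hw'.locallyIntegrable_grad
    fun φ hφ hφc => ext_inner_left ℝ fun v => ?_
  rw [← integral_inner (hw.locallyIntegrable_grad.integrable_smul_left_of_hasCompactSupport
      hφ.continuous hφc),
    ← integral_inner (hw'.locallyIntegrable_grad.integrable_smul_left_of_hasCompactSupport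
      hφ.continuous hφc)]
  have h := hw.integral_by_parts φ hφ hφc v
  rw [hw'.integral_by_parts φ hφ hφc v, neg_inj] at h
  simpa only [inner_smul_right, real_inner_comm] using h.symm

end RieszBBM

theorem theorem4p2 (n : ℕ) (hn : 2 ≤ n)
    (f : EuclideanSpace ℝ (Fin n) → ℝ) (hf : RieszBBM.MemW11 f)
    (gradf : EuclideanSpace ℝ (Fin n) → EuclideanSpace ℝ (Fin n))
    (hgradf : RieszBBM.IsWeakGradient f gradf)
    (e : EuclideanSpace ℝ (Fin n)) (he : ‖e‖ = 1)
    (α : ℕ → ℝ) (hα : ∀ k, α k ∈ Set.Ioo (0 : ℝ) 1) (hlim : Tendsto α atTop (𝓝 1)) :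
    ∃ σ : ℕ → ℕ, StrictMono σ ∧
      ∀ᵐ x : EuclideanSpace ℝ (Fin n) ∂volume,
        (∀ j, RieszBBM.rieszPotential (α (σ j)) (RieszBBM.fracDeriv (α (σ j)) f) x < ∞) ∧
        RieszBBM.rieszPotential 1 (fun y => ENNReal.ofReal ‖gradf y‖) x < ∞ ∧
        Tendsto
          (fun j => ENNReal.ofReal (1 - α (σ j)) *
            RieszBBM.rieszPotential (α (σ j)) (RieszBBM.fracDeriv (α (σ j)) f) x)
          atTop
          (𝓝 (ENNReal.ofReal (RieszBBM.sphereConst e) *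
            RieszBBM.rieszPotential 1 (fun y => ENNReal.ofReal ‖gradf y‖) x)) := by
  obtain ⟨hfi, g, hgi, hw⟩ := hf
  -- Strongly measurable representatives may be used: the potentials agree at every point, not
  -- merely almost everywhere.
  obtain ⟨f', hf'm, hff'⟩ := hfi.1
  obtain ⟨g', hg'm, hgg'⟩ := hgi.1
  -- Only local integrability of `gradf` is given; uniqueness identifies it a.e. with the integrable
  -- gradient from `MemW11`.
  have hgrad : (fun y => ENNReal.ofReal ‖gradf y‖) =ᵐ[volume] fun y => ENNReal.ofReal ‖g' y‖ := by
    filter_upwards [(hgradf.ae_eq hw).trans hgg'] with y hy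
    rw [hy]
  have hD (β : ℝ) := RieszBBM.rieszPotential_congr_ae (RieszBBM.fracDeriv_ae_congr hff' β) β
  simp only [hD, RieszBBM.rieszPotential_congr_ae hgrad]
  exact RieszBBM.exists_subseq_tendsto_rieszPotential hn (hfi.congr hff') hf'm
    (hw.congr_ae hff' hgg') (hgi.congr hgg') hg'm he (fun k => (hα k).2) hlim
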